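/- Consider $N$ homogeneous servers, each holding at most $b=b(N)\ge 1$ jobs (including the one in service). Jobs arrive in a Poisson process of rate $\lambda N$, where $\lambda=1-\gamma N^{-\alpha}$ with constants $0<\gamma\le 1$ and $\alpha>0$, and service times are i.i.d. exponential with mean one. An arriving job goes to the shorter of two servers sampled uniformly at random (power-of-two-choices). For $1\le k\le b$ let $S_k(t)$ be the fraction of servers with at least $k$ jobs at time $t$. Then $S(t)=(S_1(t),\dots,S_b(t))$ is the continuous-time Markov chain on $\{s\in (N^{-1}\mathbb Z)^b : 1\ge s_1\ge\dots\ge s_b\ge 0\}$ that, for $1\le k\le b$, jumps from $s$ to $s+e_k/N$ at rate $\lambda N(s_{k-1}^2-s_k^2)$ and to $s-e_k/N$ at rate $N(s_k-s_{k+1})$, where $e_k$ is the $k$-th unit vector, $s_0=1$ and $s_{b+1}=0$. Let $S$ have the stationary distribution of this chain, and let $s^*$, with $1\ge s_1^*\ge\dots\ge s_b^*\ge 0$, be the equilibrium point of the mean-field model, that is, the solution of \[ \lambda\big((s^*_{k-1})^2-(s^*_k)^2\big)-(s^*_k-s^*_{k+1})=0,\quad 1\le k\le b,\qquad s_0^*=1,\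 s_{b+1}^*=0 . \] Assume $b(N)=O(\log N)$ as $N\to\infty$. Then for every $\xi>0$ there is $N_0$ (which may depend on $\alpha$, $\gamma$, $\xi$ and the function $b$) such that for all $N\ge N_0$ \[ \mathbb E\big[\|S-s^*\|^2\big]\le \begin{cases} N^{-(1-2\alpha-4\xi)}, & 0<\alpha<\tfrac1{12},\\[2pt] N^{-(1-4\alpha-7\xi)}, & \tfrac1{12}\le\alpha<\tfrac14, \end{cases} \] where $\|\cdot\|$ is the Euclidean norm. -/

import Mathlib

open Filter Asymptotics

namespace Po2

noncomputable section

/-- The load `λ = 1 - γ / N ^ α` of the system with `N` servers. -/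
def load (γ α : ℝ) (N : ℕ) : ℝ := 1 - γ / (N : ℝ) ^ α

/-- The entries of `s = (s₁, …, s_b)` with the boundary conventions `s₀ = 1` and `s_k = 0` for
`k > b`. The coordinate `s_k`, `1 ≤ k ≤ b`, is stored at the index `k - 1` of `Fin b`. -/
def entry {b : ℕ} (s : EuclideanSpace ℝ (Fin b)) : ℕ → ℝ
  | 0 => 1
  | k + 1 => if h : k < b then s ⟨k, h⟩ else 0

/-- The set `𝒮` of all `s` with `1 ≥ s₁ ≥ ⋯ ≥ s_b ≥ 0`. -/
def simplex (b : ℕ) : Set (EuclideanSpace ℝ (Fin b)) :=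
  {s | (∀ i, 0 ≤ s i ∧ s i ≤ 1) ∧ ∀ i j, i ≤ j → s j ≤ s i}

/-- The (normalized) rate `lam * (s_{k-1} ^ 2 - s_k ^ 2)` at which a job joins a server with
`k - 1` jobs, where `k = i + 1`. -/
def arrival {b : ℕ} (lam : ℝ) (s : EuclideanSpace ℝ (Fin b)) (i : Fin b) : ℝ :=
  lam * (entry s i ^ 2 - entry s (i + 1) ^ 2)

/-- The (normalized) rate `s_k - s_{k+1}` at which a job leaves a server with `k` jobs,
where `k = i + 1`; for `k = b` it is `s_b`. -/
def departure {b : ℕ} (s : EuclideanSpace ℝ (Fin b)) (i : Fin b) : ℝ :=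
  entry s (i + 1) - entry s (i + 2)

/-- The mean-field vector field `f_k(s) = lam * (s_{k-1}² - s_k²) - (s_k - s_{k+1})`. -/
def meanField {b : ℕ} (lam : ℝ) (s : EuclideanSpace ℝ (Fin b)) : EuclideanSpace ℝ (Fin b) :=
  WithLp.toLp 2 fun i => arrival lam s i - departure s i

/-- `s` is an equilibrium point (in `𝒮`) of the mean-field model `ṡ = f(s)`. -/
def IsEquilibrium {b : ℕ} (lam : ℝ) (s : EuclideanSpace ℝ (Fin b)) : Prop :=
  s ∈ simplex b ∧ meanField lam s = 0

/-- The states of the system with `N` servers and buffer size `b`: `n i` is the number of servers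
that hold at least `i + 1` jobs. -/
abbrev State (N b : ℕ) : Type := {n : Fin b → Fin (N + 1) // ∀ i j, i ≤ j → n j ≤ n i}

/-- The vector of fractions `S_k` of servers that hold at least `k` jobs, `1 ≤ k ≤ b`. -/
def occupancy {N b : ℕ} (n : State N b) : EuclideanSpace ℝ (Fin b) :=
  WithLp.toLp 2 fun i => ((n.1 i : ℕ) : ℝ) / N

/-- `n'` arises from `n` when the number of servers with at least `i + 1` jobs goes up by one:
`s' = s + e_k / N` with `k = i + 1`. -/
def IsUp {N b : ℕ} (i : Fin b) (n n' : State N b) : Prop :=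
  ∀ j, (n'.1 j : ℕ) = (n.1 j : ℕ) + if j = i then 1 else 0

open Classical in
/-- The transition rates `R_{s,s'}` of the continuous-time Markov chain: Poisson arrivals of rate
`lam * N`, routed to the shorter of two uniformly sampled queues, and exponential services of
rate one. -/
def rate {N b : ℕ} (lam : ℝ) (n n' : State N b) : ℝ :=
  if n' = n then
    -∑ i, (N * arrival lam (occupancy n) i + N * departure (occupancy n) i)
  else
    ∑ i, ((if IsUp i n n' then N * arrival lam (occupancy n) i else 0) +
      (if IsUp i n' n then N * departure (occupancy n) i else 0))

/-- `p` is a stationary distribution of the chain: a probability vector on the finite set of states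
that satisfies the global balance equations `p R = 0`. -/
structure IsStationary {N b : ℕ} (lam : ℝ) (p : State N b → ℝ) : Prop where
  nonneg : ∀ n, 0 ≤ p n
  sum_eq_one : ∑ n, p n = 1
  balance : ∀ n', ∑ n, p n * rate lam n n' = 0

/-- The mean square error `E ‖S - s‖²`, where `S` is the occupancy vector of a random state with
distribution `p` and `‖·‖` is the Euclidean norm. -/
def meanSquareError {N b : ℕ} (p : State N b → ℝ) (s : EuclideanSpace ℝ (Fin b)) : ℝ :=
  ∑ n, p n * ‖occupancy n - s‖ ^ 2

end

end Po2

/-! The mean-field flow contracts a weighted `ℓ¹` distance to `s*` globally, so a Lyapunov argument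
suffices. Put `x = s - s*`. As squares factor, the drift is exactly a linear flow in `x` with
coefficients `a_k = lam * (s_k + s*_k) ≤ 1 + u_k`, where `u_k = lam * s*_k`. It contracts `∑ w_k
|x_k|` at rate `δ` once `a_k * (w_{k+1} - w_k) ≤ w_k - w_{k-1} - δ * w_k`. Increments of `w` that
shrink by the factors `1 + u_k` achieve this. At equilibrium `u_{k+1} ≤ u_k ^ 2`, so the product of
these factors is at most `1 / (1 - lam)`, and `δ = (1 - lam) / (2 * b ^ 2)` is possible
(`weight_increment_le`, `sum_weighted_flow_le`).

With `|x|` smoothed at scale `ε = N ^ (-1/2)`, the potential `Φ` satisfies `G Φ² ≤ -δ Φ² + C`, where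
`G` is the generator. Stationarity gives `E Φ² ≤ C / δ`, hence `meanSquareError_le`. Since `b` is
logarithmic, this is `N ^ (-(1 - 2α))` up to logarithms, which covers both ranges of `α`. -/

namespace Po2

open Finset

/-! ### Bounds on entries and transition rates -/

section Entry

variable {b : ℕ}

theorem entry_zero (s : EuclideanSpace ℝ (Fin b)) : entry s 0 = 1 := rfl

theorem entry_succ (s : EuclideanSpace ℝ (Fin b)) (i : Fin b) : entry s (i + 1) = s i := by
  simp [entry]

theorem entry_of_lt (s : EuclideanSpace ℝ (Fin b)) {k : ℕ} (h : b < k) : entry s k = 0 := by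
  obtain _ | k := k
  · omega
  · simp only [entry]
    rw [dif_neg (by omega)]

theorem entry_nonneg {s : EuclideanSpace ℝ (Fin b)} (hs : s ∈ simplex b) (k : ℕ) :
    0 ≤ entry s k := by
  obtain _ | k := k
  · simp [entry]
  · simp only [entry]
    split_ifs with h
    · exact (hs.1 _).1
    · exact le_rfl

theorem entry_succ_le {s : EuclideanSpace ℝ (Fin b)} (hs : s ∈ simplex b) (k : ℕ) :
    entry s (k + 1) ≤ entry s k := by
  by_cases h : k < b
  · obtain _ | k := k
    · simpa [entry, h] using (hs.1 ⟨0, h⟩).2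
    · have := hs.2 ⟨k, by omega⟩ ⟨k + 1, h⟩ (by simp)
      simpa [entry, h, show k < b by omega] using this
  · rw [entry_of_lt s (show b < k + 1 by omega)]
    exact entry_nonneg hs k

theorem entry_le_one {s : EuclideanSpace ℝ (Fin b)} (hs : s ∈ simplex b) (k : ℕ) :
    entry s k ≤ 1 := by
  induction k with
  | zero => simp [entry]
  | succ k ih => exact (entry_succ_le hs k).trans ih

theorem arrival_nonneg {lam : ℝ} (hlam : 0 ≤ lam) {s : EuclideanSpace ℝ (Fin b)}
    (hs : s ∈ simplex b) (i : Fin b) : 0 ≤ arrival lam s i := by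
  have h1 := entry_succ_le hs i
  have h2 := entry_nonneg hs (i + 1)
  exact mul_nonneg hlam (by nlinarith)

theorem arrival_le_one {lam : ℝ} (hlam' : lam ≤ 1)
    {s : EuclideanSpace ℝ (Fin b)} (hs : s ∈ simplex b) (i : Fin b) : arrival lam s i ≤ 1 := by
  have h1 := entry_le_one hs i
  have h2 := entry_nonneg hs i
  have h3 : entry s i ^ 2 - entry s (i + 1) ^ 2 ≤ 1 := by nlinarith [sq_nonneg (entry s (i + 1))]
  have h4 := entry_succ_le hs i
  have h5 := entry_nonneg hs (i + 1)
  exact mul_le_one₀ hlam' (by nlinarith) h3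

theorem departure_nonneg {s : EuclideanSpace ℝ (Fin b)} (hs : s ∈ simplex b) (i : Fin b) :
    0 ≤ departure s i :=
  sub_nonneg.2 (entry_succ_le hs (i + 1))

theorem departure_le_one {s : EuclideanSpace ℝ (Fin b)} (hs : s ∈ simplex b) (i : Fin b) :
    departure s i ≤ 1 := by
  have h1 := entry_le_one hs (i + 1)
  have h2 := entry_nonneg hs (i + 2)
  simp only [departure]
  linarith

end Entry

/-! ### The generator and stationarity -/

section Generator

variable {N b : ℕ}

theorem occupancy_mem_simplex (n : State N b) : occupancy n ∈ simplex b := by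
  refine ⟨fun i => ⟨?_, ?_⟩, fun i j hij => ?_⟩
  · simp only [occupancy]; positivity
  · simp only [occupancy]
    exact div_le_one_of_le₀ (by exact_mod_cast Nat.lt_succ_iff.1 (n.1 i).2) (by positivity)
  · simp only [occupancy]
    exact div_le_div_of_nonneg_right (by exact_mod_cast n.2 i j hij) (by positivity)

theorem IsUp.eq {i : Fin b} {n n' n'' : State N b} (h : IsUp i n n') (h' : IsUp i n n'') :
    n' = n'' :=
  Subtype.ext <| funext fun j => Fin.ext <| (h j).trans (h' j).symm

theorem IsUp.eq_left {i : Fin b} {n n' n'' : State N b} (h : IsUp i n' n) (h' : IsUp i n'' n) :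
    n' = n'' :=
  Subtype.ext <| funext fun j => Fin.ext <| by have := h j; have := h' j; omega

theorem not_isUp_self (i : Fin b) (n : State N b) : ¬ IsUp i n n := fun h => by
  simpa using h i

theorem IsUp.occupancy_eq {i : Fin b} {n n' : State N b} (h : IsUp i n n') :
    occupancy n' = occupancy n + EuclideanSpace.single i (1 / (N : ℝ)) := by
  ext j
  have hj := h j
  by_cases hji : j = i
  · subst hji
    simp [occupancy, hj, add_div]
  · simp [occupancy, hj, hji]

theorem exists_isUp {i : Fin b} {n : State N b} (h : (n.1 i : ℕ) < N)
    (h' : ∀ j < i, n.1 i < n.1 j) : ∃ m, IsUp i n m := by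
  refine ⟨⟨fun j => ⟨n.1 j + if j = i then 1 else 0, ?_⟩, fun j l hjl => ?_⟩, fun j => rfl⟩
  · have := (n.1 j).2
    split_ifs with hj
    · subst hj; omega
    · omega
  · have h1 : (n.1 l : ℕ) ≤ n.1 j := n.2 j l hjl
    simp only [Fin.mk_le_mk]
    by_cases hl : l = i
    · subst hl
      by_cases hj : j = l
      · simp [hj]
      · have : (n.1 l : ℕ) < n.1 j := h' j (lt_of_le_of_ne hjl hj)
        simp [hj]; omega
    · simp only [hl, if_false]; omega

theorem exists_isUp_left {i : Fin b} {n : State N b} (h : 0 < (n.1 i : ℕ))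
    (h' : ∀ j, i < j → n.1 j < n.1 i) : ∃ m, IsUp i m n := by
  refine ⟨⟨fun j => ⟨n.1 j - if j = i then 1 else 0, ?_⟩, fun j l hjl => ?_⟩, fun j => ?_⟩
  · have := (n.1 j).2
    omega
  · have h1 : (n.1 l : ℕ) ≤ n.1 j := n.2 j l hjl
    simp only [Fin.mk_le_mk]
    by_cases hj : j = i
    · subst hj
      by_cases hl : l = j
      · simp [hl]
      · have : (n.1 l : ℕ) < n.1 j := h' l (lt_of_le_of_ne hjl (Ne.symm hl))
        simp [hl]; omega
    · simp only [hj, if_false]; omega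
  · simp only
    split_ifs with hj
    · subst hj; omega
    · omega

/-- A nonzero rate forces a strict drop between neighbouring entries, which leaves room for the jump
inside the state space. -/
theorem exists_isUp_of_arrival_ne_zero (hN : 0 < N) {lam : ℝ} {i : Fin b} {n : State N b}
    (h : arrival lam (occupancy n) i ≠ 0) : ∃ m, IsUp i n m := by
  have hne : entry (occupancy n) (i + 1) < entry (occupancy n) i := by
    refine lt_of_le_of_ne (entry_succ_le (occupancy_mem_simplex n) _) fun he => h ?_
    simp [arrival, he]
  have hN' : (0 : ℝ) < N := by exact_mod_cast hN
  rw [entry_succ] at hne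
  have hstep : ∀ j < i, n.1 i < n.1 j := by
    intro j hj
    obtain ⟨k, hk⟩ : ∃ k, (i : ℕ) = k + 1 := ⟨i - 1, by have : (j : ℕ) < i := hj; omega⟩
    have hkb : k < b := by omega
    have he : entry (occupancy n) i = occupancy n ⟨k, hkb⟩ := by
      rw [hk]; exact entry_succ (occupancy n) ⟨k, hkb⟩
    rw [he] at hne
    simp only [occupancy] at hne
    rw [div_lt_div_iff_of_pos_right hN'] at hne
    have h1 : n.1 i < n.1 ⟨k, hkb⟩ := by
      rw [Fin.lt_def]; exact_mod_cast hne
    refine h1.trans_le (n.2 j ⟨k, hkb⟩ ?_)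
    rw [Fin.le_def]
    have : (j : ℕ) < i := hj
    simp only; omega
  refine exists_isUp ?_ hstep
  have h1 := hne.trans_le (entry_le_one (occupancy_mem_simplex n) i)
  simp only [occupancy] at h1
  rw [div_lt_one hN'] at h1
  exact_mod_cast h1

theorem exists_isUp_left_of_departure_ne_zero (hN : 0 < N) {i : Fin b} {n : State N b}
    (h : departure (occupancy n) i ≠ 0) : ∃ m, IsUp i m n := by
  have hs := occupancy_mem_simplex n
  have hne : entry (occupancy n) (i + 2) < entry (occupancy n) (i + 1) := by
    refine lt_of_le_of_ne (entry_succ_le hs _) fun he => h ?_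
    simp [departure, he]
  have hN' : (0 : ℝ) < N := by exact_mod_cast hN
  have hstep : ∀ j, i < j → n.1 j < n.1 i := by
    intro j hj
    have hij : (i : ℕ) < j := hj
    have hkb : (i : ℕ) + 1 < b := by omega
    have he : entry (occupancy n) (i + 2) = occupancy n ⟨i + 1, hkb⟩ :=
      entry_succ (occupancy n) ⟨i + 1, hkb⟩
    rw [he, entry_succ] at hne
    simp only [occupancy] at hne
    rw [div_lt_div_iff_of_pos_right hN'] at hne
    have h1 : n.1 ⟨i + 1, hkb⟩ < n.1 i := by
      rw [Fin.lt_def]; exact_mod_cast hne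
    refine lt_of_le_of_lt (n.2 ⟨i + 1, hkb⟩ j ?_) h1
    rw [Fin.le_def]
    simp only; omega
  refine exists_isUp_left ?_ hstep
  have h1 := (entry_nonneg hs (i + 2)).trans_lt hne
  rw [entry_succ] at h1
  simp only [occupancy] at h1
  rw [div_pos_iff_of_pos_right hN'] at h1
  exact_mod_cast h1

-- If the jump would leave the state space, its rate is zero, so the value of `F` there is
-- irrelevant.
open Classical in
theorem sum_isUp (hN : 0 < N) (lam : ℝ) (F : EuclideanSpace ℝ (Fin b) → ℝ) (i : Fin b)
    (n : State N b) :
    ∑ n', (if IsUp i n n' then N * arrival lam (occupancy n) i else 0) * F (occupancy n') =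
      N * arrival lam (occupancy n) i *
        F (occupancy n + EuclideanSpace.single i (1 / (N : ℝ))) := by
  by_cases h : arrival lam (occupancy n) i = 0
  · simp [h]
  · obtain ⟨m, hm⟩ := exists_isUp_of_arrival_ne_zero hN h
    have : ∀ n', IsUp i n n' ↔ n' = m := fun n' => ⟨fun h' => h'.eq hm, fun h' => h' ▸ hm⟩
    rw [← hm.occupancy_eq]
    simp [this, ite_mul]

open Classical in
theorem sum_isUp_left (hN : 0 < N) (F : EuclideanSpace ℝ (Fin b) → ℝ) (i : Fin b)
    (n : State N b) :
    ∑ n', (if IsUp i n' n then N * departure (occupancy n) i else 0) * F (occupancy n') =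
      N * departure (occupancy n) i *
        F (occupancy n - EuclideanSpace.single i (1 / (N : ℝ))) := by
  by_cases h : departure (occupancy n) i = 0
  · simp [h]
  · obtain ⟨m, hm⟩ := exists_isUp_left_of_departure_ne_zero hN h
    have : ∀ n', IsUp i n' n ↔ n' = m := fun n' => ⟨fun h' => h'.eq_left hm, fun h' => h' ▸ hm⟩
    have he : occupancy n - EuclideanSpace.single i (1 / (N : ℝ)) = occupancy m := by
      rw [hm.occupancy_eq, add_sub_cancel_right]
    rw [he]
    simp [this, ite_mul]

/-- The generator of the chain, applied to a function of the occupancy vector. -/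
theorem sum_rate_mul (hN : 0 < N) (lam : ℝ) (F : EuclideanSpace ℝ (Fin b) → ℝ) (n : State N b) :
    ∑ n', rate lam n n' * F (occupancy n') =
      ∑ i, (N * arrival lam (occupancy n) i *
          (F (occupancy n + EuclideanSpace.single i (1 / (N : ℝ))) - F (occupancy n)) +
        N * departure (occupancy n) i *
          (F (occupancy n - EuclideanSpace.single i (1 / (N : ℝ))) - F (occupancy n))) := by
  classical
  have hrate : ∀ n', rate lam n n' =
      (if n' = n then -∑ i, (N * arrival lam (occupancy n) i + N * departure (occupancy n) i)
        else 0) +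
      ∑ i, ((if IsUp i n n' then N * arrival lam (occupancy n) i else 0) +
        (if IsUp i n' n then N * departure (occupancy n) i else 0)) := by
    intro n'
    by_cases h : n' = n
    · subst h
      simp [rate, not_isUp_self]
    · simp only [rate, h, if_false, zero_add]
  simp only [hrate, add_mul, sum_add_distrib, sum_mul]
  rw [sum_comm, sum_comm (γ := State N b)]
  simp only [sum_isUp hN, sum_isUp_left hN]
  simp only [ite_mul, zero_mul, sum_ite_eq', mem_univ, if_true, mul_sub, sum_sub_distrib, neg_mul,
    add_mul, sum_mul]
  ring

theorem IsStationary.sum_mul_generator {lam : ℝ} {p : State N b → ℝ} (hp : IsStationary lam p)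
    (F : State N b → ℝ) : ∑ n, p n * ∑ n', rate lam n n' * F n' = 0 := by
  simp only [mul_sum]
  rw [sum_comm]
  refine sum_eq_zero fun n' _ => ?_
  have := congrArg (· * F n') (hp.balance n')
  simpa [sum_mul, mul_assoc] using this

end Generator

/-! ### A smoothed absolute value -/

section SmoothAbs

/-- A smooth approximation of the absolute value. -/
noncomputable def smoothAbs (ε x : ℝ) : ℝ := √(x ^ 2 + ε ^ 2)

variable {ε : ℝ}

theorem sq_smoothAbs (ε x : ℝ) : smoothAbs ε x ^ 2 = x ^ 2 + ε ^ 2 :=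
  Real.sq_sqrt (by positivity)

theorem smoothAbs_pos (hε : 0 < ε) (x : ℝ) : 0 < smoothAbs ε x :=
  Real.sqrt_pos.2 (by positivity)

theorem abs_le_smoothAbs (ε x : ℝ) : |x| ≤ smoothAbs ε x :=
  Real.abs_le_sqrt (by nlinarith [sq_nonneg ε])

theorem le_smoothAbs (ε x : ℝ) : ε ≤ smoothAbs ε x :=
  Real.le_sqrt_of_sq_le (by nlinarith [sq_nonneg x])

theorem smoothAbs_le (hε : 0 < ε) (x : ℝ) : smoothAbs ε x ≤ |x| + ε := by
  refine Real.sqrt_le_iff.2 ⟨by positivity, ?_⟩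
  nlinarith [abs_nonneg x, sq_abs x, mul_nonneg (abs_nonneg x) hε.le]

theorem abs_div_smoothAbs_le_one (hε : 0 < ε) (x : ℝ) : |x / smoothAbs ε x| ≤ 1 := by
  rw [abs_div, abs_of_pos (smoothAbs_pos hε x)]
  exact div_le_one_of_le₀ (abs_le_smoothAbs ε x) (smoothAbs_pos hε x).le

/-- With `φ = smoothAbs ε x`, the right side is `φ - ε² / φ`, and `φ` dominates both `|x|` and `ε`.
-/
theorem abs_sub_le_div_smoothAbs_mul (hε : 0 < ε) (x : ℝ) :
    |x| - ε ≤ x / smoothAbs ε x * x := by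
  have h := smoothAbs_pos hε x
  rw [div_mul_eq_mul_div, le_div_iff₀ h]
  nlinarith [sq_smoothAbs ε x, abs_le_smoothAbs ε x, le_smoothAbs ε x, abs_nonneg x]

/-- Concavity of the square root, applied to the increment `2 * x * h + h ^ 2` of the square. -/
theorem smoothAbs_add_sub_le (hε : 0 < ε) (x h : ℝ) :
    smoothAbs ε (x + h) - smoothAbs ε x ≤ x / smoothAbs ε x * h + h ^ 2 / (2 * ε) := by
  have h0 := smoothAbs_pos hε x
  have h1 : smoothAbs ε (x + h) - smoothAbs ε x ≤
      x / smoothAbs ε x * h + h ^ 2 / (2 * smoothAbs ε x) := by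
    have he : x / smoothAbs ε x * h + h ^ 2 / (2 * smoothAbs ε x) =
        (2 * x * h + h ^ 2) / (2 * smoothAbs ε x) := by field_simp
    rw [he, le_div_iff₀ (by positivity)]
    nlinarith [sq_nonneg (smoothAbs ε (x + h) - smoothAbs ε x), sq_smoothAbs ε x,
      sq_smoothAbs ε (x + h)]
  refine h1.trans (add_le_add_right ?_ _)
  gcongr
  exact le_smoothAbs ε x

theorem abs_smoothAbs_add_sub_le (hε : 0 < ε) (x h : ℝ) :
    |smoothAbs ε (x + h) - smoothAbs ε x| ≤ |h| := by
  have key : ∀ y k : ℝ, smoothAbs ε (y + k) ≤ smoothAbs ε y + |k| := by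
    intro y k
    have := smoothAbs_pos hε y
    refine Real.sqrt_le_iff.2 ⟨by positivity, ?_⟩
    have h1 := abs_le_smoothAbs ε y
    have h2 : y * k ≤ smoothAbs ε y * |k| :=
      (le_abs_self _).trans (by rw [abs_mul]; gcongr)
    nlinarith [sq_smoothAbs ε y, sq_abs k]
  rw [abs_sub_le_iff]
  constructor
  · linarith [key x h]
  · have := key (x + h) (-h)
    rw [add_neg_cancel_right, abs_neg] at this
    linarith

end SmoothAbs

/-! ### Contraction of weighted `ℓ¹` norms -/

section Drift

/-- Contraction of a weighted `ℓ¹` norm under the linear flow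
`x_k' = a_{k-1} x_{k-1} - a_k x_k - x_k + x_{k+1}`, for a smoothed sign `g` of `x`. -/
theorem sum_weighted_flow_le (b : ℕ) {δ ε : ℝ} (x a g w : ℕ → ℝ)
    (hε : 0 ≤ ε) (hx0 : x 0 = 0) (hxb : x (b + 1) = 0) (ha : ∀ k, 0 ≤ a k) (ha2 : ∀ k, a k ≤ 2)
    (hw0 : w 0 = 0) (hw : ∀ k ≤ b + 1, 0 ≤ w k) (hg : ∀ k, |g k| ≤ 1)
    (hgx : ∀ k, |x k| - ε ≤ g k * x k)
    (hd : ∀ k < b, a (k + 1) * (w (k + 2) - w (k + 1)) ≤ w (k + 1) - w k - δ * w (k + 1)) :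
    ∑ k ∈ range b, w (k + 1) * g (k + 1) *
        (a k * x k - a (k + 1) * x (k + 1) - (x (k + 1) - x (k + 2))) ≤
      ∑ k ∈ range b, (-δ * (w (k + 1) * |x (k + 1)|) + 3 * ε * w (k + 1)) := by
  have hgle : ∀ k y, g k * y ≤ |y| := fun k y => by
    refine (le_abs_self _).trans ?_
    rw [abs_mul]
    exact mul_le_of_le_one_left (abs_nonneg y) (hg k)
  -- Index shift: the term at `0` vanishes and the nonnegative term at `b` is added.
  have h1 : ∑ k ∈ range b, w (k + 1) * (a k * |x k|) ≤
      ∑ k ∈ range b, w (k + 2) * (a (k + 1) * |x (k + 1)|) := by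
    have e1 := sum_range_succ (fun k => w (k + 1) * (a k * |x k|)) b
    have e2 := sum_range_succ' (fun k => w (k + 1) * (a k * |x k|)) b
    have e3 : 0 ≤ w (b + 1) * (a b * |x b|) :=
      mul_nonneg (hw _ le_rfl) (mul_nonneg (ha b) (abs_nonneg _))
    simp only [hx0, abs_zero, mul_zero, add_zero] at e2
    linarith
  have h2 : ∑ k ∈ range b, w (k + 1) * |x (k + 2)| = ∑ k ∈ range b, w k * |x (k + 1)| := by
    have e1 := sum_range_succ (fun k => w k * |x (k + 1)|) b
    have e2 := sum_range_succ' (fun k => w k * |x (k + 1)|) b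
    simp only [hxb, abs_zero, mul_zero, add_zero, hw0, zero_mul] at e1 e2
    exact e2.symm.trans e1
  -- Only the diagonal term needs the sign of `x`; inflow from the neighbours is bounded by absolute
  -- values.
  calc _ ≤ ∑ k ∈ range b, (w (k + 1) * (a k * |x k|) + w (k + 1) * |x (k + 2)| -
        (a (k + 1) + 1) * w (k + 1) * (|x (k + 1)| - ε)) := by
        refine sum_le_sum fun k hk => ?_
        have hwk := hw (k + 1) (by have := mem_range.1 hk; omega)
        have e1 := mul_le_mul_of_nonneg_left (hgle (k + 1) (a k * x k)) hwk
        have e2 := mul_le_mul_of_nonneg_left (hgle (k + 1) (x (k + 2))) hwk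
        have e3 := mul_le_mul_of_nonneg_left (hgx (k + 1))
          (mul_nonneg (add_nonneg (ha (k + 1)) zero_le_one) hwk)
        rw [abs_mul, abs_of_nonneg (ha k)] at e1
        linarith
    _ ≤ ∑ k ∈ range b, (w (k + 2) * (a (k + 1) * |x (k + 1)|) + w k * |x (k + 1)| -
        (a (k + 1) + 1) * w (k + 1) * (|x (k + 1)| - ε)) := by
        simp only [sum_sub_distrib, sum_add_distrib]
        linarith
    _ ≤ _ := by
        refine sum_le_sum fun k hk => ?_
        have hkb := mem_range.1 hk
        have hwk := hw (k + 1) (by omega)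
        have e1 := mul_le_mul_of_nonneg_right (hd k hkb) (abs_nonneg (x (k + 1)))
        -- The smoothing error is `(a + 1) * ε ≤ 3 * ε`.
        have e2 := mul_le_mul_of_nonneg_right (ha2 (k + 1)) (mul_nonneg hε hwk)
        linarith

end Drift

/-! ### Construction of the weights -/

section Weights

/-- The product `∏_{1 ≤ j ≤ k} (1 + u_j)`. -/
def growth (u : ℕ → ℝ) (k : ℕ) : ℝ := ∏ j ∈ range k, (1 + u (j + 1))

/-- The weights of the `ℓ¹` norm that the mean-field flow contracts. -/
noncomputable def weight (b : ℕ) (u : ℕ → ℝ) (k : ℕ) : ℝ :=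
  ∑ j ∈ range k, (2 - (j + 1) / (b : ℝ)) / growth u j

variable {u : ℕ → ℝ}

theorem one_le_growth (hu : ∀ k, 0 ≤ u k) (k : ℕ) : 1 ≤ growth u k := by
  induction k with
  | zero => simp [growth]
  | succ k ih =>
    rw [growth, prod_range_succ]
    exact one_le_mul_of_one_le_of_one_le ih (by linarith [hu (k + 1)])

/-- The telescoping behind `(1 - u)(1 + u)(1 + u²)(1 + u⁴)⋯ ≤ 1`. -/
theorem growth_mul_le (hu : ∀ k, 0 ≤ u k) (hu1 : u 0 < 1) (hsq : ∀ k, u (k + 1) ≤ u k ^ 2)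
    (k : ℕ) : growth u k * (1 - u 0) ≤ 1 := by
  have key : growth u k * (1 - u 0) * (1 + u 0) ≤ 1 - u k ^ 2 := by
    induction k with
    | zero => simp only [growth, range_zero, prod_empty]; linarith
    | succ k ih =>
      rw [growth, prod_range_succ, ← growth]
      have := mul_le_mul_of_nonneg_right (ih.trans (sub_le_sub_left (hsq k) 1))
        (show 0 ≤ 1 + u (k + 1) by linarith [hu (k + 1)])
      linarith
  have h1 := mul_nonneg (mul_nonneg (zero_le_one.trans (one_le_growth hu k))
    (sub_nonneg.2 hu1.le)) (hu 0)
  linarith [sq_nonneg (u k)]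

theorem weight_succ (b : ℕ) (u : ℕ → ℝ) (k : ℕ) :
    weight b u (k + 1) = weight b u k + (2 - (k + 1) / (b : ℝ)) / growth u k :=
  sum_range_succ _ _

variable {b : ℕ}

theorem weight_le_weight_succ (hb : 1 ≤ b) (hu : ∀ k, 0 ≤ u k) {k : ℕ} (hk : k ≤ b) :
    weight b u k ≤ weight b u (k + 1) := by
  have hb' : (1 : ℝ) ≤ b := by exact_mod_cast hb
  have hk' : (k : ℝ) ≤ b := by exact_mod_cast hk
  rw [weight_succ, le_add_iff_nonneg_right]
  refine div_nonneg ?_ (zero_le_one.trans (one_le_growth hu k))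
  rw [sub_nonneg, div_le_iff₀ (by linarith)]
  linarith

theorem weight_nonneg (hb : 1 ≤ b) (hu : ∀ k, 0 ≤ u k) {k : ℕ} (hk : k ≤ b + 1) :
    0 ≤ weight b u k := by
  induction k with
  | zero => simp [weight]
  | succ k ih => exact (ih (by omega)).trans (weight_le_weight_succ hb hu (by omega))

theorem one_le_weight (hb : 1 ≤ b) (hu : ∀ k, 0 ≤ u k) {k : ℕ} (hk : k ≤ b) :
    1 ≤ weight b u (k + 1) := by
  induction k with
  | zero =>
    have hb' : (1 : ℝ) ≤ b := by exact_mod_cast hb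
    have : 1 / (b : ℝ) ≤ 1 := div_le_one_of_le₀ hb' (by linarith)
    simp only [weight, growth, zero_add, range_one, sum_singleton, range_zero, prod_empty,
      Nat.cast_zero, div_one]
    linarith
  | succ k ih => exact (ih (by omega)).trans (weight_le_weight_succ hb hu hk)

theorem weight_le (hb : 1 ≤ b) (hu : ∀ k, 0 ≤ u k) {k : ℕ} (hk : k ≤ b) :
    weight b u k ≤ 2 * b := by
  have hk' : (k : ℝ) ≤ b := by exact_mod_cast hk
  have : weight b u k ≤ ∑ _j ∈ range k, (2 : ℝ) := by
    refine sum_le_sum fun j _ => ?_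
    rw [div_le_iff₀ (zero_lt_one.trans_le (one_le_growth hu j))]
    have h1 : 0 ≤ ((j : ℝ) + 1) / b := by positivity
    linarith [one_le_growth hu j]
  simp only [sum_const, card_range, nsmul_eq_mul] at this
  linarith

/-- The weights decay along the flow at rate `(1 - u_0) / (2 b²)`. -/
theorem weight_increment_le (hb : 1 ≤ b) (hu : ∀ k, 0 ≤ u k) (hu1 : u 0 < 1)
    (hsq : ∀ k, u (k + 1) ≤ u k ^ 2) {a : ℝ} {k : ℕ} (hk : k < b) (ha : a ≤ 1 + u (k + 1)) :
    a * (weight b u (k + 2) - weight b u (k + 1)) ≤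
      weight b u (k + 1) - weight b u k - (1 - u 0) / (2 * b ^ 2) * weight b u (k + 1) := by
  have hb' : (1 : ℝ) ≤ b := by exact_mod_cast hb
  have hg := one_le_growth hu k
  have h1 := mul_le_mul_of_nonneg_right ha
    (sub_nonneg.2 (weight_le_weight_succ hb hu (show k + 1 ≤ b by omega)))
  -- The factor cancels against `growth`; the slack is the decrease `1 / b` of the numerator.
  have h2 : (1 + u (k + 1)) * (weight b u (k + 1 + 1) - weight b u (k + 1)) =
      weight b u (k + 1) - weight b u k - 1 / b / growth u k := by
    have h3 : growth u (k + 1) = growth u k * (1 + u (k + 1)) := prod_range_succ _ _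
    have h4 : 1 + u (k + 1) ≠ 0 := by linarith [hu (k + 1)]
    have h5 : growth u k ≠ 0 := by linarith
    rw [weight_succ, weight_succ, h3]
    push_cast
    field_simp
    ring
  have h6 : (1 - u 0) / (2 * b ^ 2) * weight b u (k + 1) ≤ 1 / b / growth u k := by
    calc _ ≤ (1 - u 0) / (2 * b ^ 2) * (2 * b) := by
          refine mul_le_mul_of_nonneg_left (weight_le hb hu hk) ?_
          have := sub_nonneg.2 hu1.le
          positivity
      _ = (1 - u 0) / b := by field_simp
      _ ≤ _ := by
          rw [div_div, div_le_div_iff₀ (by linarith) (by positivity)]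
          nlinarith [growth_mul_le hu hu1 hsq k]
  linarith

end Weights

/-! ### The equilibrium point -/

section Equilibrium

variable {b : ℕ}

theorem meanField_apply (lam : ℝ) (s : EuclideanSpace ℝ (Fin b)) {k : ℕ} (hk : k < b) :
    meanField lam s ⟨k, hk⟩ =
      lam * (entry s k ^ 2 - entry s (k + 1) ^ 2) - (entry s (k + 1) - entry s (k + 2)) := rfl

/-- The equilibrium equations telescope when summed from `k + 1` to `b`. -/
theorem IsEquilibrium.entry_succ_eq {lam : ℝ} {s : EuclideanSpace ℝ (Fin b)}
    (hs : IsEquilibrium lam s) {k : ℕ} (hk : k ≤ b) :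
    entry s (k + 1) = lam * (entry s k ^ 2 - entry s b ^ 2) := by
  refine Nat.decreasingInduction (motive := fun k _ => entry s (k + 1) =
    lam * (entry s k ^ 2 - entry s b ^ 2)) (fun j hj ih => ?_) ?_ hk
  · have h1 := meanField_apply lam s hj
    rw [hs.2] at h1
    simp only [PiLp.zero_apply] at h1
    linarith
  · rw [entry_of_lt s (Nat.lt_succ_self b)]
    ring

theorem IsEquilibrium.load_mul_entry_succ_le {lam : ℝ} (hlam : 0 ≤ lam)
    {s : EuclideanSpace ℝ (Fin b)} (hs : IsEquilibrium lam s) (k : ℕ) :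
    lam * entry s (k + 1) ≤ (lam * entry s k) ^ 2 := by
  by_cases hk : k ≤ b
  · rw [hs.entry_succ_eq hk]
    nlinarith [mul_nonneg (mul_nonneg hlam hlam) (sq_nonneg (entry s b))]
  · rw [entry_of_lt s (show b < k + 1 by omega), mul_zero]
    positivity

end Equilibrium

/-! ### The Lyapunov function and its drift -/

section Potential

variable {b : ℕ}

/-- The smoothed weighted `ℓ¹` distance to `s₀`. -/
noncomputable def potential (w : ℕ → ℝ) (ε : ℝ) (s₀ s : EuclideanSpace ℝ (Fin b)) : ℝ :=
  ∑ i : Fin b, w (i + 1) * smoothAbs ε (s i - s₀ i)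

theorem potential_add_single_sub (w : ℕ → ℝ) (ε : ℝ) (s₀ s : EuclideanSpace ℝ (Fin b))
    (i : Fin b) (h : ℝ) :
    potential w ε s₀ (s + EuclideanSpace.single i h) - potential w ε s₀ s =
      w (i + 1) * (smoothAbs ε (s i - s₀ i + h) - smoothAbs ε (s i - s₀ i)) := by
  rw [potential, potential, ← sum_sub_distrib, sum_eq_single i]
  · simp [add_sub_right_comm, mul_sub]
  · intro j _ hj
    simp [hj]
  · simp

theorem potential_nonneg {w : ℕ → ℝ} (hw : ∀ k < b, 0 ≤ w (k + 1)) (ε : ℝ)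
    (s₀ s : EuclideanSpace ℝ (Fin b)) : 0 ≤ potential w ε s₀ s :=
  sum_nonneg fun i _ => mul_nonneg (hw i i.2) (Real.sqrt_nonneg _)

/-- The increment of the squared potential at a jump of size `h` in the direction `i`. -/
theorem sq_potential_add_single_sub_le {w : ℕ → ℝ} (hw : ∀ k < b, 0 ≤ w (k + 1)) {ε : ℝ}
    (hε : 0 < ε) (s₀ s : EuclideanSpace ℝ (Fin b)) (i : Fin b) (h : ℝ) :
    potential w ε s₀ (s + EuclideanSpace.single i h) ^ 2 - potential w ε s₀ s ^ 2 ≤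
      2 * potential w ε s₀ s * (w (i + 1) *
        ((s i - s₀ i) / smoothAbs ε (s i - s₀ i) * h + h ^ 2 / (2 * ε))) +
      (w (i + 1) * h) ^ 2 := by
  set Φ := potential w ε s₀ s
  set Δ := potential w ε s₀ (s + EuclideanSpace.single i h) - Φ with hΔ
  have hΔ' : Δ = w (i + 1) * (smoothAbs ε (s i - s₀ i + h) - smoothAbs ε (s i - s₀ i)) :=
    potential_add_single_sub w ε s₀ s i h
  have h1 : potential w ε s₀ (s + EuclideanSpace.single i h) ^ 2 - Φ ^ 2 =
      2 * Φ * Δ + Δ ^ 2 := by rw [hΔ]; ring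
  rw [h1]
  have hΦ : 0 ≤ Φ := potential_nonneg hw ε s₀ s
  refine add_le_add (mul_le_mul_of_nonneg_left ?_ (by positivity)) ?_
  · rw [hΔ']
    exact mul_le_mul_of_nonneg_left (smoothAbs_add_sub_le hε _ _) (hw i i.2)
  · rw [hΔ', mul_pow, mul_pow]
    exact mul_le_mul_of_nonneg_left (sq_le_sq.2 (abs_smoothAbs_add_sub_le hε _ _)) (sq_nonneg _)

theorem sq_norm_sub_le_sq_potential {w : ℕ → ℝ} (hw : ∀ k < b, 1 ≤ w (k + 1)) (ε : ℝ)
    (s₀ s : EuclideanSpace ℝ (Fin b)) : ‖s - s₀‖ ^ 2 ≤ potential w ε s₀ s ^ 2 := by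
  rw [EuclideanSpace.norm_sq_eq]
  calc ∑ i, ‖(s - s₀) i‖ ^ 2 ≤ (∑ i, ‖(s - s₀) i‖) ^ 2 :=
        sum_sq_le_sq_sum_of_nonneg fun i _ => norm_nonneg _
    _ ≤ _ := by
        refine pow_le_pow_left₀ (sum_nonneg fun i _ => norm_nonneg _) (sum_le_sum fun i _ => ?_) 2
        have h1 : ‖(s - s₀) i‖ ≤ smoothAbs ε (s i - s₀ i) := abs_le_smoothAbs ε _
        exact h1.trans (le_mul_of_one_le_left (Real.sqrt_nonneg _) (hw i i.2))

/-- The drift of the potential along the mean-field vector field. -/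
theorem sum_weight_mul_meanField_le {lam : ℝ} (hlam : 0 ≤ lam) (hlam1 : lam < 1) (hb : 1 ≤ b)
    {s₀ s : EuclideanSpace ℝ (Fin b)} (hs₀ : IsEquilibrium lam s₀) (hs : s ∈ simplex b) {ε : ℝ}
    (hε : 0 < ε) {w : ℕ → ℝ} (hw : w = weight b fun k => lam * entry s₀ k) {δ : ℝ}
    (hδ : δ = (1 - lam) / (2 * b ^ 2)) :
    ∑ i : Fin b, w (i + 1) * ((s i - s₀ i) / smoothAbs ε (s i - s₀ i)) *
        (arrival lam s i - departure s i) ≤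
      -δ * potential w ε s₀ s + (3 + δ) * ε * ∑ i : Fin b, w (i + 1) := by
  set u : ℕ → ℝ := fun k => lam * entry s₀ k with hu_def
  have hu : ∀ k, 0 ≤ u k := fun k => mul_nonneg hlam (entry_nonneg hs₀.1 k)
  have hu0 : u 0 = lam := by simp [hu_def, entry_zero]
  have hsq : ∀ k, u (k + 1) ≤ u k ^ 2 := hs₀.load_mul_entry_succ_le hlam
  have hwn : ∀ k ≤ b + 1, 0 ≤ w k := fun k hk => hw ▸ weight_nonneg hb hu hk
  have hδ0 : 0 ≤ δ := by
    rw [hδ]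
    have := sub_nonneg.2 hlam1.le
    positivity
  have key := sum_weighted_flow_le b (δ := δ) (ε := ε)
    (fun k => entry s k - entry s₀ k) (fun k => lam * (entry s k + entry s₀ k))
    (fun k => (entry s k - entry s₀ k) / smoothAbs ε (entry s k - entry s₀ k)) w hε.le
    (by simp [entry_zero]) (by simp [entry_of_lt])
    (fun k => mul_nonneg hlam (add_nonneg (entry_nonneg hs k) (entry_nonneg hs₀.1 k)))
    (fun k => by nlinarith [entry_le_one hs k, entry_le_one hs₀.1 k])
    (by simp [hw, weight]) hwn
    (fun k => abs_div_smoothAbs_le_one hε _) (fun k => abs_sub_le_div_smoothAbs_mul hε _)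
    (fun k hk => by
      rw [hδ, ← hu0, hw]
      refine weight_increment_le hb hu (by rwa [hu0]) hsq hk ?_
      rw [hu0, hu_def]
      -- Here `lam * s_{k+1} ≤ 1`, whatever the state `s`.
      nlinarith [entry_le_one hs (k + 1), entry_nonneg hs (k + 1)])
  rw [← Fin.sum_univ_eq_sum_range (fun k => w (k + 1) * ((entry s (k + 1) - entry s₀ (k + 1)) /
      smoothAbs ε (entry s (k + 1) - entry s₀ (k + 1))) *
      (lam * (entry s k + entry s₀ k) * (entry s k - entry s₀ k) -
        lam * (entry s (k + 1) + entry s₀ (k + 1)) * (entry s (k + 1) - entry s₀ (k + 1)) -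
        (entry s (k + 1) - entry s₀ (k + 1) - (entry s (k + 2) - entry s₀ (k + 2))))),
    ← Fin.sum_univ_eq_sum_range (fun k => -δ * (w (k + 1) * |entry s (k + 1) - entry s₀ (k + 1)|) +
      3 * ε * w (k + 1))] at key
  -- Subtracting the equilibrium equation and factoring the squares leaves no linearization error.
  have hL : ∀ i : Fin b, arrival lam s i - departure s i =
      lam * (entry s i + entry s₀ i) * (entry s i - entry s₀ i) -
        lam * (entry s (i + 1) + entry s₀ (i + 1)) * (entry s (i + 1) - entry s₀ (i + 1)) -
        (entry s (i + 1) - entry s₀ (i + 1) - (entry s (i + 2) - entry s₀ (i + 2))) := by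
    intro i
    have h1 := meanField_apply lam s₀ i.2
    rw [hs₀.2] at h1
    simp only [PiLp.zero_apply] at h1
    simp only [arrival, departure]
    linarith
  simp only [hL, ← entry_succ]
  refine key.trans ?_
  rw [potential, mul_sum, mul_sum, ← sum_add_distrib]
  refine sum_le_sum fun i _ => ?_
  have h1 := mul_le_mul_of_nonneg_left (smoothAbs_le hε (entry s (i + 1) - entry s₀ (i + 1)))
    (mul_nonneg hδ0 (hwn (i + 1) (by omega)))
  rw [← entry_succ s, ← entry_succ s₀]
  linarith

end Potential

/-! ### The mean square error bound -/

section MeanSquareError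

variable {N b : ℕ}

/-- The generator of the chain, applied to the squared potential. -/
theorem generator_sq_potential_le (hN : 0 < N) {lam : ℝ} (hlam : 0 ≤ lam) (hlam1 : lam < 1)
    (hb : 1 ≤ b) {s₀ : EuclideanSpace ℝ (Fin b)} (hs₀ : IsEquilibrium lam s₀) {ε : ℝ}
    (hε : 0 < ε) (hεN : ε ^ 2 * N = 1) {w : ℕ → ℝ} (hw : w = weight b fun k => lam * entry s₀ k)
    {δ : ℝ} (hδ : δ = (1 - lam) / (2 * b ^ 2)) (n : State N b) :
    ∑ n', rate lam n n' * potential w ε s₀ (occupancy n') ^ 2 ≤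
      2 * potential w ε s₀ (occupancy n) * (-δ * potential w ε s₀ (occupancy n) +
        (4 + δ) * ε * ∑ i : Fin b, w (i + 1)) + 2 * (ε * ∑ i : Fin b, w (i + 1)) ^ 2 := by
  have hN' : (0 : ℝ) < N := by exact_mod_cast hN
  have hu : ∀ k, 0 ≤ lam * entry s₀ k := fun k => mul_nonneg hlam (entry_nonneg hs₀.1 k)
  have hwn : ∀ k < b, 0 ≤ w (k + 1) := fun k hk => hw ▸ weight_nonneg hb hu (by omega)
  have hs := occupancy_mem_simplex n
  rw [sum_rate_mul hN lam fun s => potential w ε s₀ s ^ 2]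
  set s := occupancy n
  set Φ := potential w ε s₀ s with hΦ_def
  have hΦ : 0 ≤ Φ := potential_nonneg hwn ε s₀ s
  have hinv : 1 / (N : ℝ) = ε ^ 2 := by field_simp; linarith
  have hdrift := sum_weight_mul_meanField_le hlam hlam1 hb hs₀ hs hε hw hδ
  have hterm : ∀ i : Fin b, N * arrival lam s i *
          (potential w ε s₀ (s + EuclideanSpace.single i (1 / (N : ℝ))) ^ 2 - Φ ^ 2) +
        N * departure s i *
          (potential w ε s₀ (s - EuclideanSpace.single i (1 / (N : ℝ))) ^ 2 - Φ ^ 2) ≤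
      2 * Φ * (w (i + 1) * ((s i - s₀ i) / smoothAbs ε (s i - s₀ i)) *
        (arrival lam s i - departure s i)) + 2 * Φ * ε * w (i + 1) +
        2 * ε ^ 2 * w (i + 1) ^ 2 := by
    intro i
    have hA := arrival_nonneg hlam hs i
    have hD := departure_nonneg hs i
    have hA1 := arrival_le_one hlam1.le hs i
    have hD1 := departure_le_one hs i
    have h1 := sq_potential_add_single_sub_le hwn hε s₀ s i (1 / (N : ℝ))
    have h2 := sq_potential_add_single_sub_le hwn hε s₀ s i (-(1 / (N : ℝ)))
    have hneg : s + EuclideanSpace.single i (-(1 / (N : ℝ))) =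
        s - EuclideanSpace.single i (1 / (N : ℝ)) := by
      ext j
      by_cases hj : j = i <;> simp [hj, sub_eq_add_neg]
    rw [hneg] at h2
    have h1' := mul_le_mul_of_nonneg_left h1 (mul_nonneg hN'.le hA)
    have h2' := mul_le_mul_of_nonneg_left h2 (mul_nonneg hN'.le hD)
    refine (add_le_add h1' h2').trans ?_
    rw [← hΦ_def, hinv]
    set g := (s i - s₀ i) / smoothAbs ε (s i - s₀ i)
    have hwi := hwn i i.2
    have e1 : (ε ^ 2) ^ 2 / (2 * ε) = ε ^ 2 * (ε / 2) := by field_simp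
    have e2 : (-ε ^ 2) ^ 2 / (2 * ε) = ε ^ 2 * (ε / 2) := by field_simp
    rw [e1, e2]
    -- First-order terms combine to arrival minus departure, second-order ones to the sum of the
    -- rates, which is at most `2`.
    have e3 : N * arrival lam s i * (2 * Φ * (w (i + 1) * (g * ε ^ 2 + ε ^ 2 * (ε / 2))) +
          (w (i + 1) * ε ^ 2) ^ 2) +
        N * departure s i * (2 * Φ * (w (i + 1) * (g * -ε ^ 2 + ε ^ 2 * (ε / 2))) +
          (w (i + 1) * -ε ^ 2) ^ 2) =
        (ε ^ 2 * N) * (2 * Φ * (w (i + 1) * g * (arrival lam s i - departure s i)) +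
          (arrival lam s i + departure s i) * (Φ * ε * w (i + 1) + ε ^ 2 * w (i + 1) ^ 2)) := by
      ring
    rw [e3, hεN, one_mul]
    have e4 : 0 ≤ Φ * ε * w (i + 1) + ε ^ 2 * w (i + 1) ^ 2 := by positivity
    have e5 := mul_le_mul_of_nonneg_right (show arrival lam s i + departure s i ≤ 2 by linarith) e4
    linarith
  refine (sum_le_sum fun i _ => hterm i).trans ?_
  rw [sum_add_distrib, sum_add_distrib, ← mul_sum, ← mul_sum, ← mul_sum]
  have h1 := mul_le_mul_of_nonneg_left hdrift (mul_nonneg zero_le_two hΦ)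
  have h2 : ∑ i : Fin b, w (i + 1) ^ 2 ≤ (∑ i : Fin b, w (i + 1)) ^ 2 :=
    sum_sq_le_sq_sum_of_nonneg fun i _ => hwn i i.2
  have h3 := mul_le_mul_of_nonneg_left h2 (show 0 ≤ 2 * ε ^ 2 by positivity)
  rw [← hΦ_def] at h1
  linarith

theorem meanSquareError_le (hN : 0 < N) {lam : ℝ} (hlam : 0 ≤ lam) (hlam1 : lam < 1)
    (hb : 1 ≤ b) {s₀ : EuclideanSpace ℝ (Fin b)} (hs₀ : IsEquilibrium lam s₀)
    {p : State N b → ℝ} (hp : IsStationary lam p) :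
    meanSquareError p s₀ ≤ 432 * (b : ℝ) ^ 8 / (N * (1 - lam) ^ 2) := by
  have hN' : (0 : ℝ) < N := by exact_mod_cast hN
  have hb' : (1 : ℝ) ≤ b := by exact_mod_cast hb
  -- This scale balances the smoothing error `ε` with the curvature error `1 / (N * ε)`.
  obtain ⟨ε, hε, hεN⟩ : ∃ ε : ℝ, 0 < ε ∧ ε ^ 2 * N = 1 :=
    ⟨1 / √N, by positivity, by rw [div_pow, Real.sq_sqrt hN'.le]; field_simp⟩
  obtain ⟨w, hw⟩ : ∃ w, w = weight b fun k => lam * entry s₀ k := ⟨_, rfl⟩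
  obtain ⟨δ, hδ⟩ : ∃ δ, δ = (1 - lam) / (2 * (b : ℝ) ^ 2) := ⟨_, rfl⟩
  have hu : ∀ k, 0 ≤ lam * entry s₀ k := fun k => mul_nonneg hlam (entry_nonneg hs₀.1 k)
  have hw1 : ∀ k < b, 1 ≤ w (k + 1) := fun k hk => hw ▸ one_le_weight hb hu hk.le
  have hw2 : ∀ k < b, w (k + 1) ≤ 2 * b := fun k hk => hw ▸ weight_le hb hu hk
  have h1lam : 0 < 1 - lam := sub_pos.2 hlam1
  have hδ0 : 0 < δ := by rw [hδ]; positivity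
  have hδ1 : δ ≤ 1 := by
    rw [hδ, div_le_one (by positivity)]
    nlinarith
  set W := ∑ i : Fin b, w (i + 1) with hW
  have hW0 : 0 ≤ W := sum_nonneg fun i _ => zero_le_one.trans (hw1 i i.2)
  have hW1 : W ≤ 2 * b ^ 2 := by
    have : W ≤ ∑ _i : Fin b, (2 * b : ℝ) := sum_le_sum fun i _ => hw2 i i.2
    simp only [sum_const, card_univ, Fintype.card_fin, nsmul_eq_mul] at this
    linarith
  -- With `E = ε * W`, completing the square in `10 * Φ * E` costs `25 * E² / δ`; the jump term adds
  -- `2 * E² ≤ 2 * E² / δ`.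
  set C := 27 * (ε * W) ^ 2 / δ with hC
  have hgen : ∀ n : State N b, ∑ n', rate lam n n' * potential w ε s₀ (occupancy n') ^ 2 ≤
      -δ * potential w ε s₀ (occupancy n) ^ 2 + C := by
    intro n
    refine (generator_sq_potential_le hN hlam hlam1 hb hs₀ hε hεN hw hδ n).trans ?_
    rw [← hW]
    have hΦ : 0 ≤ potential w ε s₀ (occupancy n) :=
      potential_nonneg (fun k hk => zero_le_one.trans (hw1 k hk)) ε s₀ _
    set Φ := potential w ε s₀ (occupancy n)
    set E := ε * W with hE
    have hE0 : 0 ≤ E := mul_nonneg hε.le hW0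
    have hC' : C * δ = 27 * E ^ 2 := by rw [hC]; field_simp
    have e1 : 2 * Φ * (-δ * Φ + (4 + δ) * ε * W) ≤ -2 * δ * Φ ^ 2 + 10 * Φ * E := by
      have := mul_le_mul_of_nonneg_right hδ1 (mul_nonneg hΦ hE0)
      rw [hE] at this ⊢
      linarith
    have e2 : (10 * Φ * E + 2 * E ^ 2) * δ ≤ (δ * Φ ^ 2 + C) * δ := by
      rw [add_mul _ C, hC']
      nlinarith [sq_nonneg (δ * Φ - 5 * E), mul_le_mul_of_nonneg_right hδ1 (sq_nonneg E)]
    have e3 := le_of_mul_le_mul_right e2 hδ0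
    linarith
  have hsum : ∑ n, p n * potential w ε s₀ (occupancy n) ^ 2 ≤ C / δ := by
    have h0 := hp.sum_mul_generator fun n => potential w ε s₀ (occupancy n) ^ 2
    have h1 := sum_le_sum fun n (_ : n ∈ univ) => mul_le_mul_of_nonneg_left (hgen n) (hp.nonneg n)
    rw [h0] at h1
    have h2 : ∑ n, p n * (-δ * potential w ε s₀ (occupancy n) ^ 2 + C) =
        -δ * (∑ n, p n * potential w ε s₀ (occupancy n) ^ 2) + C := by
      have : ∑ n, p n * C = C := by rw [← sum_mul, hp.sum_eq_one, one_mul]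
      simp only [mul_add, sum_add_distrib, this, mul_sum]
      congr 1
      exact sum_congr rfl fun n _ => by ring
    rw [h2] at h1
    rw [le_div_iff₀ hδ0]
    linarith
  calc meanSquareError p s₀ ≤ ∑ n, p n * potential w ε s₀ (occupancy n) ^ 2 :=
        sum_le_sum fun n _ => mul_le_mul_of_nonneg_left
          (sq_norm_sub_le_sq_potential hw1 ε s₀ _) (hp.nonneg n)
    _ ≤ C / δ := hsum
    _ = 27 * ε ^ 2 * W ^ 2 / δ ^ 2 := by rw [hC]; field_simp
    _ ≤ 27 * ε ^ 2 * (2 * b ^ 2) ^ 2 / δ ^ 2 := by gcongr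
    _ = _ := by
        have : ε ^ 2 = 1 / N := by field_simp; linarith
        rw [this, hδ]
        field_simp
        norm_num

end MeanSquareError

/-! ### Asymptotics in `N` -/

theorem eventually_mul_pow_le_rpow {b : ℕ → ℕ}
    (hbO : (fun N : ℕ => (b N : ℝ)) =O[atTop] (fun N : ℕ => Real.log (N : ℝ))) (K : ℝ) (m : ℕ)
    {η : ℝ} (hη : 0 < η) : ∀ᶠ N : ℕ in atTop, K * (b N : ℝ) ^ m ≤ (N : ℝ) ^ η := by
  have h1 : (fun N : ℕ => K * (b N : ℝ) ^ m) =O[atTop] fun N : ℕ => Real.log (N : ℝ) ^ m :=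
    (hbO.pow m).const_mul_left K
  have h2 : (fun N : ℕ => Real.log (N : ℝ) ^ m) =o[atTop] fun N : ℕ => (N : ℝ) ^ η := by
    have := (isLittleO_log_rpow_rpow_atTop (m : ℝ) hη).comp_tendsto tendsto_natCast_atTop_atTop
    simpa [Function.comp_def] using this
  filter_upwards [(h1.trans_isLittleO h2).bound zero_lt_one] with N hN
  rw [one_mul, Real.norm_of_nonneg (Real.rpow_nonneg N.cast_nonneg η)] at hN
  exact (le_abs_self _).trans hN

end Po2

theorem theorem2 (α γ ξ : ℝ) (hα : 0 < α) (hα' : α < 1 / 4) (hγ : 0 < γ) (hγ' : γ ≤ 1)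
    (hξ : 0 < ξ) (b : ℕ → ℕ) (hb : ∀ N, 1 ≤ b N)
    (hbO : (fun N : ℕ => (b N : ℝ)) =O[atTop] (fun N : ℕ => Real.log (N : ℝ))) :
    ∀ᶠ N : ℕ in atTop,
      ∀ (s : EuclideanSpace ℝ (Fin (b N))) (p : Po2.State N (b N) → ℝ),
        Po2.IsEquilibrium (Po2.load γ α N) s →
        Po2.IsStationary (Po2.load γ α N) p →
          (α < 1 / 12 →
            Po2.meanSquareError p s ≤ 1 / (N : ℝ) ^ (1 - 2 * α - 4 * ξ)) ∧
          (1 / 12 ≤ α →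
            Po2.meanSquareError p s ≤ 1 / (N : ℝ) ^ (1 - 4 * α - 7 * ξ)) := by
  filter_upwards [Po2.eventually_mul_pow_le_rpow hbO (432 / γ ^ 2) 8 hξ, eventually_ge_atTop 1]
    with N hbN hN s p hs hp
  have hN1 : (1 : ℝ) ≤ N := by exact_mod_cast hN
  have hN0 : (0 : ℝ) < N := zero_lt_one.trans_le hN1
  have hNα : 1 ≤ (N : ℝ) ^ α := Real.one_le_rpow hN1 hα.le
  have hlam1 : Po2.load γ α N < 1 := by
    have : 0 < γ / (N : ℝ) ^ α := by positivity
    simp only [Po2.load]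
    linarith
  have hlam0 : 0 ≤ Po2.load γ α N := by
    simp only [Po2.load, sub_nonneg]
    exact div_le_one_of_le₀ (hγ'.trans hNα) (by positivity)
  -- One bound serves both ranges, its exponent being at least each of the required ones; `N ^ ξ`
  -- absorbs the constant and `b ^ 8`.
  have hmain : Po2.meanSquareError p s ≤ 1 / (N : ℝ) ^ (1 - 2 * α - ξ) := by
    refine (Po2.meanSquareError_le hN hlam0 hlam1 (hb N) hs hp).trans ?_
    have e1 : 1 - Po2.load γ α N = γ / (N : ℝ) ^ α := by simp [Po2.load]
    have e2 : (N : ℝ) ^ (1 - 2 * α - ξ) = N / ((N : ℝ) ^ α) ^ 2 / (N : ℝ) ^ ξ := by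
      rw [Real.rpow_sub hN0, Real.rpow_sub hN0, Real.rpow_one, mul_comm 2 α, Real.rpow_mul hN0.le,
        Real.rpow_two]
    rw [e1, e2]
    calc 432 * (b N : ℝ) ^ 8 / (N * (γ / (N : ℝ) ^ α) ^ 2)
        = 432 / γ ^ 2 * (b N : ℝ) ^ 8 * (((N : ℝ) ^ α) ^ 2 / N) := by field_simp
      _ ≤ (N : ℝ) ^ ξ * (((N : ℝ) ^ α) ^ 2 / N) := by gcongr
      _ = _ := by field_simp
  have hmono : ∀ c : ℝ, c ≤ 1 - 2 * α - ξ → Po2.meanSquareError p s ≤ 1 / (N : ℝ) ^ c :=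
    fun c hc => hmain.trans <| one_div_le_one_div_of_le (by positivity)
      (Real.rpow_le_rpow_of_exponent_le hN1 hc)
  exact ⟨fun _ => hmono _ (by linarith), fun _ => hmono _ (by linarith)⟩
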